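/- Let $\mathbb D$ be the open unit disc and let $1\le p<\infty$. Let $\omega:\mathbb D\to[0,\infty)$ be a regular weight, that is, $\omega$ is integrable over $\mathbb D$, radial ($\omega(z)=\omega(|z|)$), and there are constants $c,C>0$ with $$c\,\omega(r)(1-r)\le\int_r^1\omega(s)\,ds\le C\,\omega(r)(1-r)\qquad(0\le r<1).$$ Let $A^p_\omega$ be the space of analytic functions $f$ on $\mathbb D$ with $\|f\|_{A^p_\omega}^p=\int_{\mathbb D}|f(z)|^p\omega(z)\,dA(z)<\infty$, where $dA=\frac1\pi\,dx\,dy$. Let $(\varphi_t)_{t\ge0}$ be a semigroup of analytic self-maps of $\mathbb D$: $\varphi_0(z)=z$, $\varphi_t\circ\varphi_s=\varphi_{t+s}$ for $t,s\ge0$, and $\varphi_t(z)\to z$ as $t\to0^+$ for every $z\in\mathbb D$. Let $(m_t)_{t\ge0}$ be a cocycle for $(\varphi_t)$: every $m_t$ is analytic on $\mathbb D$, $m_0=1$, $m_{t+s}(z)=m_t(z)\,m_s(\varphi_t(z))$ for all $t,s\ge0$ and $z\in\mathbb D$, and $m_t(z)\to1$ as $t\to0^+$ for every $z\in\mathbb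 D$. Suppose that $$\limsup_{t\to0^+}\|m_t\|_{H^\infty}<\infty,\qquad \|m\|_{H^\infty}=\sup_{z\in\mathbb D}|m(z)|\in[0,\infty].$$ Then the formula $(S_tf)(z)=m_t(z)f(\varphi_t(z))$ defines bounded linear operators $S_t$ on $A^p_\omega$ for all $t\ge0$, with $S_0=I$ and $S_tS_s=S_{t+s}$ for $t,s\ge0$, and this semigroup is strongly continuous: $\|S_tf-f\|_{A^p_\omega}\to0$ as $t\to0^+$ for every $f\in A^p_\omega$. -/

import Mathlib

open MeasureTheory Filter Topology
open scoped ENNReal NNReal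

namespace WeightedComposition

/-- The open unit disc of the complex plane, with the topology inherited from `ℂ`. -/
abbrev Disc : Type := Metric.ball (0 : ℂ) 1

/-- `f : Disc → ℂ` is analytic: it is the restriction of a function that is complex
differentiable on the open unit disc. -/
def IsAnalyticOnDisc (f : Disc → ℂ) : Prop :=
  ∃ F : ℂ → ℂ, DifferentiableOn ℂ F (Metric.ball (0 : ℂ) 1) ∧ ∀ z : Disc, f z = F z

/-- The norm of `H^∞`, with the value `∞` for an unbounded function. -/
noncomputable def hardyInfNorm (f : Disc → ℂ) : ℝ≥0∞ := ⨆ z : Disc, ‖f z‖ₑ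

/-- A regular weight; only the values of `ω` on the open unit disc matter. -/
structure IsRegularWeight (ω : ℂ → ℝ) : Prop where
  nonneg : ∀ z ∈ Metric.ball (0 : ℂ) 1, 0 ≤ ω z
  integrableOn : IntegrableOn ω (Metric.ball (0 : ℂ) 1)
  radial : ∀ z ∈ Metric.ball (0 : ℂ) 1, ω z = ω (‖z‖ : ℂ)
  /-- The tail integrals below are finite. -/
  intervalIntegrable : IntervalIntegrable (fun s : ℝ => ω (s : ℂ)) volume 0 1
  regular : ∃ c C : ℝ, 0 < c ∧ 0 < C ∧ ∀ r ∈ Set.Ico (0 : ℝ) 1,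
    c * (ω (r : ℂ) * (1 - r)) ≤ ∫ s in r..1, ω (s : ℂ) ∧
      ∫ s in r..1, ω (s : ℂ) ≤ C * (ω (r : ℂ) * (1 - r))

/-- The measure `ω dA` on the disc, where `dA` is `dx dy / π`. -/
noncomputable def weightMeasure (ω : ℂ → ℝ) : Measure Disc :=
  (Measure.comap ((↑) : Disc → ℂ) volume).withDensity (fun z => ENNReal.ofReal (ω z / Real.pi))

/-- The functions that make up the weighted Bergman space `A^p_ω`. -/
noncomputable def bergmanSubmodule (p : ℝ≥0∞) (ω : ℂ → ℝ) : Submodule ℂ (Disc → ℂ) where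
  carrier := {f | IsAnalyticOnDisc f ∧ MemLp f p (weightMeasure ω)}
  add_mem' := by
    rintro f g ⟨⟨F, hF, hf⟩, hf'⟩ ⟨⟨G, hG, hg⟩, hg'⟩
    exact ⟨⟨F + G, hF.add hG, fun z => by simp [hf, hg]⟩, hf'.add hg'⟩
  zero_mem' := ⟨⟨0, differentiableOn_const 0, fun _ => rfl⟩, MemLp.zero⟩
  smul_mem' := by
    rintro a f ⟨⟨F, hF, hf⟩, hf'⟩
    exact ⟨⟨a • F, hF.const_smul a, fun z => by simp [hf]⟩, hf'.const_smul a⟩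

/-- The weighted Bergman space `A^p_ω`. -/
def BergmanSpace (p : ℝ≥0∞) (ω : ℂ → ℝ) : Type := bergmanSubmodule p ω

namespace BergmanSpace

variable {p : ℝ≥0∞} {ω : ℂ → ℝ}

noncomputable instance : AddCommGroup (BergmanSpace p ω) :=
  inferInstanceAs (AddCommGroup (bergmanSubmodule p ω))

noncomputable instance : Module ℂ (BergmanSpace p ω) :=
  inferInstanceAs (Module ℂ (bergmanSubmodule p ω))

instance : CoeFun (BergmanSpace p ω) (fun _ => Disc → ℂ) := ⟨fun f => f.1⟩

/-- For `1 ≤ p < ∞` this is `(∫ |f|^p ω dA)^(1/p)`. -/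
noncomputable instance : Norm (BergmanSpace p ω) :=
  ⟨fun f => (eLpNorm f p (weightMeasure ω)).toReal⟩

theorem norm_core [Fact (1 ≤ p)] : SeminormedSpace.Core ℂ (BergmanSpace p ω) where
  norm_nonneg _ := ENNReal.toReal_nonneg
  norm_smul c f := by
    change (eLpNorm (c • f.1) p (weightMeasure ω)).toReal = _
    rw [eLpNorm_const_smul, ENNReal.toReal_mul, toReal_enorm]
    rfl
  norm_triangle f g := by
    change (eLpNorm (f.1 + g.1) p (weightMeasure ω)).toReal ≤ _
    refine (ENNReal.toReal_mono (ENNReal.add_ne_top.2 ⟨f.2.2.2.ne, g.2.2.2.ne⟩)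
      (eLpNorm_add_le f.2.2.1 g.2.2.1 Fact.out)).trans_eq ?_
    exact ENNReal.toReal_add f.2.2.2.ne g.2.2.2.ne

noncomputable instance [Fact (1 ≤ p)] : SeminormedAddCommGroup (BergmanSpace p ω) :=
  SeminormedAddCommGroup.ofCore norm_core

noncomputable instance [Fact (1 ≤ p)] : NormedSpace ℂ (BergmanSpace p ω) where
  norm_smul_le c f := (norm_core.norm_smul c f).le

end BergmanSpace

/-- A semigroup of analytic self-maps of the disc. -/
structure IsAnalyticSemigroup (φ : ℝ≥0 → Disc → Disc) : Prop where
  analytic : ∀ t, IsAnalyticOnDisc (fun z => (φ t z : ℂ))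
  zero : ∀ z, φ 0 z = z
  add : ∀ t s z, φ t (φ s z) = φ (t + s) z
  tendsto : ∀ z, Tendsto (fun t => φ t z) (𝓝[>] 0) (𝓝 z)

/-- A cocycle for `φ`. As in the theory of weighted composition semigroups, a cocycle is
pointwise continuous in time; convergence to `1` at time `0` is all that has to be asked. -/
structure IsCocycle (φ : ℝ≥0 → Disc → Disc) (m : ℝ≥0 → Disc → ℂ) : Prop where
  analytic : ∀ t, IsAnalyticOnDisc (m t)
  zero : ∀ z, m 0 z = 1
  add : ∀ t s z, m (t + s) z = m t z * m s (φ t z)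
  tendsto : ∀ z, Tendsto (fun t => m t z) (𝓝[>] 0) (𝓝 1)

/-- A strongly continuous semigroup of bounded linear operators. -/
structure IsStronglyContinuousSemigroup {X : Type*} [SeminormedAddCommGroup X]
    [NormedSpace ℂ X] (T : ℝ≥0 → X →L[ℂ] X) : Prop where
  zero : T 0 = ContinuousLinearMap.id ℂ X
  add : ∀ t s, (T t).comp (T s) = T (t + s)
  tendsto : ∀ f, Tendsto (fun t => T t f) (𝓝[>] 0) (𝓝 f)

end WeightedComposition

namespace WeightedComposition

open Set Metric

/-! Everything rests on a bound for composition operators near the boundary that is uniform over all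
symbols `Φ` with `‖Φ 0‖ ≤ α < 1`. By Schwarz–Pick, `Φ` sends the closed disc of radius `r` into a
disc of radius `1 - κ * (1 - r)`, with `κ` depending only on `α`. Subordination (Poisson, Jensen,
and harmonicity of the Poisson kernel along `Φ`) bounds the mean of `|F ∘ Φ|^q` over the smaller
circle by that of `|F|^q` over the larger one. Regularity gives `ω(r) ≤ K ω(1 - κ(1 - r))`, so an
affine change of radius yields `exists_setLIntegral_comp_le`. Radii only grow, so the bound holds on
each annulus `ρ < |z|` separately.

Taking the whole disc gives boundedness of each `S_t`; finiteness of the norm of `m_t` for all `t`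
follows from submultiplicativity. For strong continuity, choose `ρ` so that `f` has small norm on
the outer annulus; the bound makes `S_t f` small there for all small `t`. On the remaining compact
disc, dominated convergence applies. No density of polynomials is needed. -/

/-! ### Poisson integrals and subordination on circles -/

/-- Periodicity shifts the angle to `(-π, π)`, the range used by polar coordinates. -/
theorem circleAverage_eq_setIntegral_Ioo {E : Type*} [NormedAddCommGroup E] [NormedSpace ℝ E]
    (f : ℂ → E) (c : ℂ) (R : ℝ) :
    Real.circleAverage f c R =
      ∫ θ in Ioo (-Real.pi) Real.pi, (2 * Real.pi)⁻¹ • f (circleMap c R θ) := by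
  rw [Real.circleAverage_def, integral_smul, ← integral_Ioc_eq_integral_Ioo,
    ← intervalIntegral.integral_of_le (by linarith [Real.pi_pos])]
  have hper : Function.Periodic (fun θ => f (circleMap c R θ)) (2 * Real.pi) :=
    (periodic_circleMap c R).comp f
  have := hper.intervalIntegral_add_eq 0 (-Real.pi)
  rw [zero_add, show -Real.pi + 2 * Real.pi = Real.pi by ring] at this
  rw [this]

theorem poissonKernel_nonneg {R : ℝ} {w z : ℂ} (hw : w ∈ ball (0 : ℂ) R)
    (hz : z ∈ sphere (0 : ℂ) R) : 0 ≤ poissonKernel 0 w z := by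
  simp only [mem_ball_zero_iff, mem_sphere_zero_iff_norm] at hw hz
  simp only [poissonKernel_def, sub_zero]
  have : ‖w‖ ^ 2 ≤ ‖z‖ ^ 2 := by rw [hz]; gcongr
  exact div_nonneg (sub_nonneg.2 this) (by positivity)

theorem continuous_poissonKernel_circleMap {R : ℝ} (hR : 0 < R) {w : ℂ}
    (hw : w ∈ ball (0 : ℂ) R) : Continuous fun θ => poissonKernel 0 w (circleMap 0 R θ) := by
  simp only [poissonKernel_def, sub_zero]
  refine Continuous.div (by fun_prop) (by fun_prop) fun θ => ?_
  have : circleMap 0 R θ ≠ w := by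
    rintro rfl
    simp [abs_of_pos hR] at hw
  simpa [sub_eq_zero] using this

/-- The Poisson kernel at a point of the disc, as a density in the angular variable. -/
noncomputable def poissonDensity (R : ℝ) (w : ℂ) (θ : ℝ) : ℝ :=
  (2 * Real.pi)⁻¹ * poissonKernel 0 w (circleMap 0 R θ)

theorem poissonDensity_nonneg {R : ℝ} (hR : 0 < R) {w : ℂ} (hw : w ∈ ball (0 : ℂ) R) (θ : ℝ) :
    0 ≤ poissonDensity R w θ :=
  mul_nonneg (by positivity) (poissonKernel_nonneg hw (circleMap_mem_sphere 0 hR.le θ))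

theorem continuous_poissonDensity {R : ℝ} (hR : 0 < R) {w : ℂ} (hw : w ∈ ball (0 : ℂ) R) :
    Continuous (poissonDensity R w) :=
  continuous_const.mul (continuous_poissonKernel_circleMap hR hw)

theorem integral_poissonDensity_smul {F : ℂ → ℂ} (hF : DifferentiableOn ℂ F (ball 0 1)) {R : ℝ}
    (hR1 : R < 1) {w : ℂ} (hw : w ∈ ball (0 : ℂ) R) :
    ∫ θ in Ioo (-Real.pi) Real.pi, poissonDensity R w θ • F (circleMap 0 R θ) = F w := by
  have h : DiffContOnCl ℂ F (ball 0 R) :=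
    (hF.mono (closedBall_subset_ball hR1)).diffContOnCl_ball subset_rfl
  rw [← h.circleAverage_poissonKernel_smul hw, circleAverage_eq_setIntegral_Ioo]
  simp only [poissonDensity, Pi.smul_apply', smul_smul]

theorem continuous_comp_circleMap {F : ℂ → ℂ} (hF : DifferentiableOn ℂ F (ball 0 1)) {R : ℝ}
    (hR : 0 ≤ R) (hR1 : R < 1) : Continuous fun θ => F (circleMap 0 R θ) :=
  hF.continuousOn.comp_continuous (continuous_circleMap 0 R) fun θ =>
    sphere_subset_closedBall.trans (closedBall_subset_ball hR1) (circleMap_mem_sphere 0 hR θ)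

/-- Poisson's formula combined with Jensen's inequality. -/
theorem enorm_rpow_le_lintegral_poissonDensity {F : ℂ → ℂ}
    (hF : DifferentiableOn ℂ F (ball 0 1)) {R : ℝ} (hR : 0 < R) (hR1 : R < 1) {w : ℂ}
    (hw : w ∈ ball (0 : ℂ) R) {q : ℝ} (hq : 1 ≤ q) :
    ‖F w‖ₑ ^ q ≤ ∫⁻ θ in Ioo (-Real.pi) Real.pi,
      ENNReal.ofReal (poissonDensity R w θ) * ‖F (circleMap 0 R θ)‖ₑ ^ q := by
  set μ : Measure ℝ := volume.restrict (Ioo (-Real.pi) Real.pi) with hμ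
  set d : ℝ → ℝ≥0∞ := fun θ => ENNReal.ofReal (poissonDensity R w θ) with hd
  have hcd := continuous_poissonDensity hR hw
  have hdm : Measurable d := hcd.measurable.ennreal_ofReal
  have hFc := continuous_comp_circleMap hF hR.le hR1
  have hint : Integrable (poissonDensity R w) μ :=
    (hcd.integrableOn_Icc (a := -Real.pi) (b := Real.pi)).mono_set Ioo_subset_Icc_self
  -- Total mass one is Poisson's formula for the constant function 1.
  have hone : ∫ θ, poissonDensity R w θ ∂μ = 1 := by
    have := integral_poissonDensity_smul (F := fun _ => 1) (differentiableOn_const _) hR1 hw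
    have h2 : ((∫ θ, poissonDensity R w θ ∂μ : ℝ) : ℂ) = 1 := by
      rw [← integral_complex_ofReal, ← this]
      simp [hμ]
    exact_mod_cast h2
  have hprob : IsProbabilityMeasure (μ.withDensity d) := by
    constructor
    rw [withDensity_apply _ MeasurableSet.univ, Measure.restrict_univ, hd,
      ← ofReal_integral_eq_lintegral_ofReal hint
        (ae_of_all _ fun θ => poissonDensity_nonneg hR hw θ), hone, ENNReal.ofReal_one]
  have h1 : ‖F w‖ₑ ≤ eLpNorm (fun θ => F (circleMap 0 R θ)) 1 (μ.withDensity d) := by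
    rw [eLpNorm_one_eq_lintegral_enorm, lintegral_withDensity_eq_lintegral_mul _ hdm
      hFc.measurable.enorm, ← integral_poissonDensity_smul hF hR1 hw]
    refine (enorm_integral_le_lintegral_enorm _).trans_eq (lintegral_congr fun θ => ?_)
    simp only [hd, enorm_smul, Pi.mul_apply]
    rw [Real.enorm_of_nonneg (poissonDensity_nonneg hR hw θ)]
  have hq0 : 0 < q := by linarith
  -- Jensen's inequality, as monotonicity of `L^q` norms over a probability measure.
  have h2 := eLpNorm_le_eLpNorm_of_exponent_le (p := 1) (q := ENNReal.ofReal q)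
    (by rw [← ENNReal.ofReal_one]; exact ENNReal.ofReal_le_ofReal hq)
    (hFc.aestronglyMeasurable (μ := μ.withDensity d))
  have h3 := ENNReal.rpow_le_rpow (h1.trans h2) hq0.le
  rw [eLpNorm_eq_lintegral_rpow_enorm_toReal (by simpa using hq0) ENNReal.ofReal_ne_top,
    ENNReal.toReal_ofReal hq0.le, ← ENNReal.rpow_mul, one_div_mul_cancel hq0.ne',
    ENNReal.rpow_one, lintegral_withDensity_eq_lintegral_mul _ hdm
      (hFc.measurable.enorm.pow_const q)] at h3
  exact h3

/-- For fixed `ζ` on the outer circle, the Poisson kernel at `Φ z` is the real part of the analytic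
function `(ζ + Φ z) / (ζ - Φ z)`. Its circle mean is therefore its value at 0, which Harnack's
inequality bounds. -/
theorem lintegral_poissonDensity_comp_le {Φ : ℂ → ℂ} (hΦ : DifferentiableOn ℂ Φ (ball 0 1))
    {r R : ℝ} (hr : 0 ≤ r) (hr1 : r < 1) (hR : 0 < R)
    (hmap : MapsTo Φ (closedBall 0 r) (ball 0 R)) (τ : ℝ) :
    ∫⁻ θ in Ioo (-Real.pi) Real.pi, ENNReal.ofReal (poissonDensity R (Φ (circleMap 0 r θ)) τ) ≤
      ENNReal.ofReal ((R + ‖Φ 0‖) / (R - ‖Φ 0‖)) := by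
  set ζ := circleMap 0 R τ with hζ
  have hζs : ζ ∈ sphere (0 : ℂ) R := circleMap_mem_sphere 0 hR.le τ
  set H : ℂ → ℂ := fun z => (ζ + Φ z) / (ζ - Φ z) with hH
  have hne : ∀ z ∈ closedBall (0 : ℂ) r, ζ - Φ z ≠ 0 := by
    intro z hz h
    have h1 := hmap hz
    rw [← sub_eq_zero.1 h] at h1
    rw [mem_ball_zero_iff] at h1
    rw [mem_sphere_zero_iff_norm] at hζs
    linarith
  have hΦ' := hΦ.mono (closedBall_subset_ball hr1)
  have hHd : DifferentiableOn ℂ H (closedBall 0 r) :=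
    ((differentiableOn_const _).add hΦ').div ((differentiableOn_const _).sub hΦ') hne
  have hmean : Real.circleAverage H 0 r = H 0 := by
    refine DiffContOnCl.circleAverage ?_
    rw [abs_of_nonneg hr]
    exact hHd.diffContOnCl_ball subset_rfl
  rw [circleAverage_eq_setIntegral_Ioo] at hmean
  have hmem : ∀ θ, circleMap 0 r θ ∈ closedBall (0 : ℂ) r := fun θ =>
    sphere_subset_closedBall (circleMap_mem_sphere 0 hr θ)
  have hcont : Continuous fun θ => H (circleMap 0 r θ) :=
    hHd.continuousOn.comp_continuous (continuous_circleMap 0 r) hmem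
  have hpk : ∀ z, poissonKernel 0 (Φ z) ζ = (H z).re := by
    intro z
    rw [poissonKernel_eq_re_herglotzRieszKernel]
    simp [hH, herglotzRieszKernel_def]
  have hint : IntegrableOn (fun θ => (2 * Real.pi)⁻¹ • H (circleMap 0 r θ))
      (Ioo (-Real.pi) Real.pi) :=
    ((hcont.const_smul (2 * Real.pi)⁻¹).integrableOn_Icc (a := -Real.pi) (b := Real.pi)).mono_set
      Ioo_subset_Icc_self
  have hre := integral_re hint
  rw [hmean] at hre
  have hpd : ∀ θ, poissonDensity R (Φ (circleMap 0 r θ)) τ =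
      RCLike.re ((2 * Real.pi)⁻¹ • H (circleMap 0 r θ)) := by
    intro θ
    rw [poissonDensity, ← hζ, hpk]
    exact (Complex.smul_re (2 * Real.pi)⁻¹ (H (circleMap 0 r θ))).symm
  simp_rw [← hpd] at hre
  rw [← ofReal_integral_eq_lintegral_ofReal, hre]
  · refine ENNReal.ofReal_le_ofReal ?_
    have := re_herglotzRieszKernel_le hζs (hmap (mem_closedBall_self hr))
    simpa [hH] using this
  · have := hint.re
    simp_rw [← hpd] at this
    exact this
  · exact ae_of_all _ fun θ => poissonDensity_nonneg hR (hmap (hmem θ)) τ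

/-- Subordination for integral means over circles. -/
theorem lintegral_circle_comp_le {F Φ : ℂ → ℂ} (hF : DifferentiableOn ℂ F (ball 0 1))
    (hΦ : DifferentiableOn ℂ Φ (ball 0 1)) {r R : ℝ} (hr : 0 ≤ r) (hr1 : r < 1) (hR : 0 < R)
    (hR1 : R < 1) (hmap : MapsTo Φ (closedBall 0 r) (ball 0 R)) {q : ℝ} (hq : 1 ≤ q) :
    ∫⁻ θ in Ioo (-Real.pi) Real.pi, ‖F (Φ (circleMap 0 r θ))‖ₑ ^ q ≤
      ENNReal.ofReal ((R + ‖Φ 0‖) / (R - ‖Φ 0‖)) *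
        ∫⁻ θ in Ioo (-Real.pi) Real.pi, ‖F (circleMap 0 R θ)‖ₑ ^ q := by
  have hmem : ∀ θ, Φ (circleMap 0 r θ) ∈ ball (0 : ℂ) R := fun θ =>
    hmap (sphere_subset_closedBall (circleMap_mem_sphere 0 hr θ))
  have hFc := continuous_comp_circleMap hF hR.le hR1
  have hΦc := continuous_comp_circleMap hΦ hr hr1
  have hcont : Continuous fun x : ℝ × ℝ => poissonDensity R (Φ (circleMap 0 r x.1)) x.2 := by
    simp only [poissonDensity, poissonKernel_def, sub_zero]
    have h1 : Continuous fun x : ℝ × ℝ => Φ (circleMap 0 r x.1) := hΦc.comp continuous_fst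
    have h2 : Continuous fun x : ℝ × ℝ => circleMap 0 R x.2 :=
      (continuous_circleMap 0 R).comp continuous_snd
    refine continuous_const.mul (((h2.norm.pow 2).sub (h1.norm.pow 2)).div ((h2.sub h1).norm.pow 2) fun x => ?_)
    have : circleMap 0 R x.2 ≠ Φ (circleMap 0 r x.1) := by
      intro h
      have := hmem x.1
      rw [← h] at this
      simp [abs_of_pos hR] at this
    simpa [sub_eq_zero] using this
  calc ∫⁻ θ in Ioo (-Real.pi) Real.pi, ‖F (Φ (circleMap 0 r θ))‖ₑ ^ q
      ≤ ∫⁻ θ in Ioo (-Real.pi) Real.pi, ∫⁻ τ in Ioo (-Real.pi) Real.pi,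
          ENNReal.ofReal (poissonDensity R (Φ (circleMap 0 r θ)) τ) *
            ‖F (circleMap 0 R τ)‖ₑ ^ q :=
        lintegral_mono fun θ => enorm_rpow_le_lintegral_poissonDensity hF hR hR1 (hmem θ) hq
    -- Tonelli: the inner integral now averages the kernel over the points `Φ (circleMap 0 r θ)`,
    -- where the mean value bound applies.
    _ = ∫⁻ τ in Ioo (-Real.pi) Real.pi, ∫⁻ θ in Ioo (-Real.pi) Real.pi,
          ENNReal.ofReal (poissonDensity R (Φ (circleMap 0 r θ)) τ) *
            ‖F (circleMap 0 R τ)‖ₑ ^ q := by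
        refine lintegral_lintegral_swap (Measurable.aemeasurable ?_)
        exact hcont.measurable.ennreal_ofReal.mul
          ((hFc.comp continuous_snd).measurable.enorm.pow_const q)
    _ ≤ ∫⁻ τ in Ioo (-Real.pi) Real.pi, ENNReal.ofReal ((R + ‖Φ 0‖) / (R - ‖Φ 0‖)) *
          ‖F (circleMap 0 R τ)‖ₑ ^ q := by
        refine lintegral_mono fun τ => ?_
        rw [lintegral_mul_const]
        · exact mul_le_mul_left (lintegral_poissonDensity_comp_le hΦ hr hr1 hR hmap τ) _
        · exact (hcont.comp (Continuous.prodMk_left τ)).measurable.ennreal_ofReal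
    _ = _ := lintegral_const_mul _ (hFc.measurable.enorm.pow_const q)

/-! ### Distance to the boundary under analytic self-maps -/

/-- A weak form of the Schwarz–Pick lemma. -/
theorem le_one_sub_norm_of_mapsTo_ball {Φ : ℂ → ℂ} (hΦ : DifferentiableOn ℂ Φ (ball 0 1))
    (hmap : MapsTo Φ (ball 0 1) (ball 0 1)) {z : ℂ} (hz : z ∈ ball (0 : ℂ) 1) :
    (1 - ‖Φ 0‖) * (1 - ‖z‖) / 8 ≤ 1 - ‖Φ z‖ := by
  set a := Φ 0 with ha
  have ha1 : ‖a‖ < 1 := by simpa using hmap (mem_ball_self one_pos)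
  have hden : ∀ w : ℂ, ‖w‖ < 1 → 1 - (starRingEnd ℂ) a * w ≠ 0 := by
    intro w hw h
    have h1 : (starRingEnd ℂ) a * w = 1 := (sub_eq_zero.1 h).symm
    have h2 : ‖a‖ * ‖w‖ = 1 := by simpa using congrArg norm h1
    nlinarith [norm_nonneg a, norm_nonneg w]
  have hid : ∀ w : ℂ, ‖1 - (starRingEnd ℂ) a * w‖ ^ 2 - ‖w - a‖ ^ 2 =
      (1 - ‖a‖ ^ 2) * (1 - ‖w‖ ^ 2) := by
    intro w
    simp only [← Complex.normSq_eq_norm_sq, Complex.normSq_apply]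
    simp
    ring
  -- Following `Φ` by the disc automorphism that sends `a = Φ 0` to 0 makes Schwarz's lemma
  -- applicable.
  set G : ℂ → ℂ := fun z => (Φ z - a) / (1 - (starRingEnd ℂ) a * Φ z) with hG
  have hGd : DifferentiableOn ℂ G (ball 0 1) :=
    (hΦ.sub (differentiableOn_const _)).div
      ((differentiableOn_const _).sub ((differentiableOn_const _).mul hΦ))
      fun w hw => hden _ (by simpa using hmap hw)
  have hGm : MapsTo G (ball 0 1) (closedBall 0 1) := by
    intro w hw
    have hw1 : ‖Φ w‖ < 1 := by simpa using hmap hw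
    rw [mem_closedBall_zero_iff, hG, norm_div, div_le_one (norm_pos_iff.2 (hden _ hw1))]
    have := hid (Φ w)
    refine le_of_sq_le_sq ?_ (norm_nonneg _)
    nlinarith [mul_nonneg (show 0 ≤ 1 - ‖a‖ ^ 2 by nlinarith [norm_nonneg a])
      (show 0 ≤ 1 - ‖Φ w‖ ^ 2 by nlinarith [norm_nonneg (Φ w)])]
  have hz1 : ‖z‖ < 1 := by simpa using hz
  have hS := Complex.norm_le_norm_of_mapsTo_ball hGd hGm (by simp [hG, ha]) hz1
  have hw1 : ‖Φ z‖ < 1 := by simpa using hmap hz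
  rw [hG, norm_div, div_le_iff₀ (norm_pos_iff.2 (hden _ hw1))] at hS
  have hS2 := hid (Φ z)
  set D := ‖1 - (starRingEnd ℂ) a * Φ z‖ with hD
  have hDlow : 1 - ‖a‖ ≤ D := by
    have h1 : ‖(1 : ℂ)‖ - ‖(starRingEnd ℂ) a * Φ z‖ ≤ D := norm_sub_norm_le _ _
    have h2 : ‖(starRingEnd ℂ) a * Φ z‖ ≤ ‖a‖ := by
      rw [norm_mul, RCLike.norm_conj]
      exact mul_le_of_le_one_right (norm_nonneg _) hw1.le
    rw [norm_one] at h1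
    linarith
  have hsq : ‖Φ z - a‖ ^ 2 ≤ (‖z‖ * D) ^ 2 := by gcongr
  -- By `hid` the right side is `D² - ‖Φ z - a‖²`, hence at least `D² (1 - ‖z‖²)`. The estimates
  -- below then give the constant 4; the 8 in the statement is weaker.
  have h1 : (1 - ‖a‖) ^ 2 * (1 - ‖z‖ ^ 2) ≤ (1 - ‖a‖ ^ 2) * (1 - ‖Φ z‖ ^ 2) := by
    have : (1 - ‖a‖) ^ 2 ≤ D ^ 2 := by gcongr
    nlinarith [mul_le_mul_of_nonneg_right this
      (show 0 ≤ 1 - ‖z‖ ^ 2 by nlinarith [norm_nonneg z])]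
  have h2 : (1 - ‖a‖) * (1 - ‖z‖ ^ 2) ≤ (1 + ‖a‖) * (1 - ‖Φ z‖ ^ 2) := by
    refine le_of_mul_le_mul_left ?_ (sub_pos.2 ha1)
    nlinarith
  have h3 : (1 - ‖a‖) * (1 - ‖z‖) ≤ (1 - ‖a‖) * (1 - ‖z‖ ^ 2) := by
    refine mul_le_mul_of_nonneg_left ?_ (sub_nonneg.2 ha1.le)
    nlinarith [norm_nonneg z]
  have h4 : (1 + ‖a‖) * (1 - ‖Φ z‖ ^ 2) ≤ 2 * (2 * (1 - ‖Φ z‖)) := by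
    refine mul_le_mul (by linarith) (by nlinarith [norm_nonneg (Φ z)]) ?_ (by norm_num)
    nlinarith [norm_nonneg (Φ z)]
  linarith

/-! ### Tails and doubling of regular weights -/

namespace IsRegularWeight

variable {ω : ℂ → ℝ}

theorem nonneg_ofReal (hω : IsRegularWeight ω) {s : ℝ} (hs : s ∈ Ico (0 : ℝ) 1) :
    0 ≤ ω (s : ℂ) :=
  hω.nonneg _ (by simpa [abs_of_nonneg hs.1] using hs.2)

theorem intervalIntegrable_of_mem (hω : IsRegularWeight ω) {a b : ℝ} (ha : a ∈ Icc (0 : ℝ) 1)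
    (hb : b ∈ Icc (0 : ℝ) 1) : IntervalIntegrable (fun s : ℝ => ω (s : ℂ)) volume a b :=
  hω.intervalIntegrable.mono_set (by
    rw [uIcc_of_le zero_le_one]
    exact uIcc_subset_Icc ha hb)

theorem intervalIntegral_nonneg (hω : IsRegularWeight ω) {a b : ℝ} (ha : 0 ≤ a) (hab : a ≤ b)
    (hb : b ≤ 1) : 0 ≤ ∫ s in a..b, ω (s : ℂ) := by
  rw [intervalIntegral.integral_of_le hab, integral_Ioc_eq_integral_Ioo]
  exact setIntegral_nonneg measurableSet_Ioo fun s hs =>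
    hω.nonneg_ofReal ⟨ha.trans hs.1.le, hs.2.trans_le hb⟩

theorem tail_add (hω : IsRegularWeight ω) {r s : ℝ} (hr : 0 ≤ r) (hrs : r ≤ s) (hs : s ≤ 1) :
    (∫ x in r..s, ω (x : ℂ)) + ∫ x in s..1, ω (x : ℂ) = ∫ x in r..1, ω (x : ℂ) :=
  intervalIntegral.integral_add_adjacent_intervals
    (hω.intervalIntegrable_of_mem ⟨hr, hrs.trans hs⟩ ⟨hr.trans hrs, hs⟩)
    (hω.intervalIntegrable_of_mem ⟨hr.trans hrs, hs⟩ ⟨zero_le_one, le_rfl⟩)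

theorem tail_anti (hω : IsRegularWeight ω) {r s : ℝ} (hr : 0 ≤ r) (hrs : r ≤ s) (hs : s ≤ 1) :
    ∫ x in s..1, ω (x : ℂ) ≤ ∫ x in r..1, ω (x : ℂ) := by
  rw [← hω.tail_add hr hrs hs]
  linarith [hω.intervalIntegral_nonneg hr hrs hs]

/-- On `[r, s]` the lower regularity bound gives `ω(x) ≤ W / (c (1 - s))`, with `W` the tail from
`r`. So this short interval carries at most half of `W`. -/
theorem tail_le_two_mul (hω : IsRegularWeight ω) {c : ℝ} (hc : 0 < c)
    (hlow : ∀ r ∈ Ico (0 : ℝ) 1, c * (ω (r : ℂ) * (1 - r)) ≤ ∫ s in r..1, ω (s : ℂ))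
    {r s : ℝ} (hr : 0 ≤ r) (hrs : r ≤ s) (hs : s < 1) (hclose : s - r ≤ c / 2 * (1 - s)) :
    ∫ x in r..1, ω (x : ℂ) ≤ 2 * ∫ x in s..1, ω (x : ℂ) := by
  set W := ∫ x in r..1, ω (x : ℂ) with hW
  have hW0 : 0 ≤ W := hω.intervalIntegral_nonneg hr (hrs.trans hs.le) le_rfl
  have h1s : 0 < 1 - s := sub_pos.2 hs
  have hbound : ∫ x in r..s, ω (x : ℂ) ≤ ∫ _ in r..s, W / (c * (1 - s)) := by
    refine intervalIntegral.integral_mono_on hrs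
      (hω.intervalIntegrable_of_mem ⟨hr, hrs.trans hs.le⟩ ⟨hr.trans hrs, hs.le⟩) (by simp) ?_
    intro x hx
    have hx0 : 0 ≤ x := hr.trans hx.1
    have hx1 : x < 1 := hx.2.trans_lt hs
    rw [le_div_iff₀ (by positivity)]
    have h1 := (hlow x ⟨hx0, hx1⟩).trans (hω.tail_anti hr hx.1 hx1.le)
    have h2 : ω (x : ℂ) * (1 - s) ≤ ω (x : ℂ) * (1 - x) :=
      mul_le_mul_of_nonneg_left (by linarith [hx.2]) (hω.nonneg_ofReal ⟨hx0, hx1⟩)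
    nlinarith
  have hconst : ∫ _ in r..s, W / (c * (1 - s)) ≤ W / 2 := by
    rw [intervalIntegral.integral_const, smul_eq_mul, mul_div_assoc', div_le_div_iff₀
      (by positivity) (by norm_num)]
    nlinarith
  have := hω.tail_add hr hrs hs.le
  linarith

/-- Iterates `tail_le_two_mul`. The ratio `q = (1 + c / 2)⁻¹` is the one for which passing from
distance `d` to `q * d` from the boundary meets the closeness condition with equality. -/
theorem tail_le_two_pow_mul (hω : IsRegularWeight ω) {c : ℝ} (hc : 0 < c)
    (hlow : ∀ r ∈ Ico (0 : ℝ) 1, c * (ω (r : ℂ) * (1 - r)) ≤ ∫ s in r..1, ω (s : ℂ))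
    {r : ℝ} (hr : r ∈ Ico (0 : ℝ) 1) (n : ℕ) :
    ∫ x in r..1, ω (x : ℂ) ≤
      2 ^ n * ∫ x in (1 - (1 + c / 2)⁻¹ ^ n * (1 - r))..1, ω (x : ℂ) := by
  set q := (1 + c / 2)⁻¹ with hq
  have hq0 : 0 < q := by positivity
  have hq1 : q ≤ 1 := inv_le_one_of_one_le₀ (by linarith)
  have hqc : 1 - q = c / 2 * q := by
    rw [hq]
    field_simp
    ring
  induction n with
  | zero => simp
  | succ n ih =>
    have h1r : 0 < 1 - r := sub_pos.2 hr.2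
    have hqn : q ^ n ≤ 1 := pow_le_one₀ hq0.le hq1
    have hqn0 : 0 < q ^ n := pow_pos hq0 n
    have hd : 0 < q ^ n * (1 - r) := mul_pos hqn0 h1r
    have hd1 : q ^ n * (1 - r) ≤ 1 := by nlinarith [hr.1]
    have hstep := hω.tail_le_two_mul hc hlow (r := 1 - q ^ n * (1 - r))
      (s := 1 - q ^ (n + 1) * (1 - r)) (by linarith) (by rw [pow_succ]; nlinarith)
      (by rw [pow_succ]; nlinarith [mul_pos hd hq0]) (le_of_eq (by
        rw [pow_succ]
        linear_combination q ^ n * (1 - r) * hqc))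
    calc _ ≤ _ := ih
      _ ≤ 2 ^ n * (2 * _) := mul_le_mul_of_nonneg_left hstep (by positivity)
      _ = _ := by ring

/-- A regular weight is essentially unchanged when the distance to the boundary is multiplied by
a constant. -/
theorem exists_le_mul (hω : IsRegularWeight ω) {κ : ℝ} (hκ : 0 < κ) (hκ1 : κ ≤ 1) :
    ∃ K : ℝ, 0 < K ∧ ∀ r ∈ Ico (0 : ℝ) 1,
      ω (r : ℂ) ≤ K * ω ((1 - κ * (1 - r) : ℝ) : ℂ) := by
  obtain ⟨c, C, hc, hC, hreg⟩ := hω.regular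
  obtain ⟨n, hn⟩ := exists_pow_lt_of_lt_one hκ
    (inv_lt_one_of_one_lt₀ (by linarith : 1 < 1 + c / 2))
  -- Lower regularity at `r` costs `1 / c`, the `n` doublings cost `2 ^ n`, and upper regularity at
  -- `1 - κ * (1 - r)` costs `C * κ`; since `q ^ n < κ`, the `n` doublings reach past that radius.
  refine ⟨2 ^ n * C * κ / c, by positivity, fun r hr => ?_⟩
  have h1r : 0 < 1 - r := sub_pos.2 hr.2
  have hs : 1 - κ * (1 - r) ∈ Ico (0 : ℝ) 1 :=
    ⟨by nlinarith [hr.1], by nlinarith [mul_pos hκ h1r]⟩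
  have h1 := (hreg r hr).1
  have h2 := hω.tail_le_two_pow_mul hc (fun r hr => (hreg r hr).1) hr n
  have hqn : 0 < (1 + c / 2)⁻¹ ^ n := by positivity
  have h3 := hω.tail_anti hs.1 (s := 1 - (1 + c / 2)⁻¹ ^ n * (1 - r))
    (by nlinarith) (by nlinarith)
  have h4 := (hreg _ hs).2
  have h5 : c * (ω (r : ℂ) * (1 - r)) ≤
      2 ^ n * (C * (ω ((1 - κ * (1 - r) : ℝ) : ℂ) * (κ * (1 - r)))) := by
    refine h1.trans (h2.trans (mul_le_mul_of_nonneg_left (h3.trans (h4.trans_eq ?_))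
      (by positivity)))
    ring
  rw [div_mul_eq_mul_div, le_div_iff₀ hc]
  refine le_of_mul_le_mul_right ?_ h1r
  linarith

/-! ### The measure `ω dA` in polar coordinates -/

theorem aemeasurable_ofReal (hω : IsRegularWeight ω) :
    AEMeasurable (fun s : ℝ => ω (s : ℂ)) (volume.restrict (Ioo 0 1)) :=
  (((intervalIntegrable_iff_integrableOn_Ioo_of_le zero_le_one).1
    hω.intervalIntegrable).aestronglyMeasurable).aemeasurable

theorem aemeasurable_density (hω : IsRegularWeight ω) :
    AEMeasurable (fun z : Disc => ENNReal.ofReal (ω z / Real.pi))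
      (Measure.comap ((↑) : Disc → ℂ) volume) := by
  have h : AEMeasurable (fun z : ℂ => ENNReal.ofReal (ω z / Real.pi))
      (volume.restrict (ball (0 : ℂ) 1)) :=
    (hω.integrableOn.aestronglyMeasurable.aemeasurable.div_const _).ennreal_ofReal
  rw [← map_comap_subtype_coe measurableSet_ball] at h
  exact h.comp_measurable measurable_subtype_coe

theorem isFiniteMeasure (hω : IsRegularWeight ω) : IsFiniteMeasure (weightMeasure ω) := by
  refine isFiniteMeasure_withDensity ?_
  rw [lintegral_subtype_comap measurableSet_ball fun z : ℂ => ENNReal.ofReal (ω z / Real.pi)]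
  exact (hω.integrableOn.div_const Real.pi).lintegral_lt_top.ne

/-- Integration in polar coordinates. -/
theorem lintegral_weightMeasure (hω : IsRegularWeight ω) {g : ℂ → ℝ≥0∞} (hg : Measurable g) :
    ∫⁻ z : Disc, g z ∂weightMeasure ω =
      ∫⁻ r in Ioo (0 : ℝ) 1, ENNReal.ofReal (r * (ω (r : ℂ) / Real.pi)) *
        ∫⁻ θ in Ioo (-Real.pi) Real.pi, g (circleMap 0 r θ) := by
  rw [weightMeasure, lintegral_withDensity_eq_lintegral_mul₀ hω.aemeasurable_density
    (g := fun z : Disc => g z) (hg.comp measurable_subtype_coe).aemeasurable]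
  simp only [Pi.mul_apply]
  rw [lintegral_subtype_comap measurableSet_ball
    fun z : ℂ => ENNReal.ofReal (ω z / Real.pi) * g z, ← lintegral_indicator measurableSet_ball,
    ← Complex.lintegral_comp_polarCoord_symm, polarCoord_target]
  have hcm : Continuous fun x : ℝ × ℝ => circleMap 0 x.1 x.2 := by
    simp only [circleMap]
    fun_prop
  -- The radial density is cut off at 1 because polar coordinates run over all positive radii, while
  -- `ω` is controlled only on the disc.
  set d : ℝ → ℝ≥0∞ :=
    (Ioo (0 : ℝ) 1).indicator fun r => ENNReal.ofReal (r * (ω (r : ℂ) / Real.pi)) with hd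
  have hdm : AEMeasurable d (volume.restrict (Ioi (0 : ℝ))) := by
    rw [hd, aemeasurable_indicator_iff measurableSet_Ioo,
      Measure.restrict_restrict measurableSet_Ioo,
      inter_eq_left.2 (Ioo_subset_Ioi_self : Ioo (0 : ℝ) 1 ⊆ Ioi 0)]
    exact (aemeasurable_id.mul (hω.aemeasurable_ofReal.div_const _)).ennreal_ofReal
  have hcongr : ∀ x ∈ Ioi (0 : ℝ) ×ˢ Ioo (-Real.pi) Real.pi,
      ENNReal.ofReal x.1 • (ball (0 : ℂ) 1).indicator
        (fun z : ℂ => ENNReal.ofReal (ω z / Real.pi) * g z) (Complex.polarCoord.symm x) =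
      d x.1 * g (circleMap 0 x.1 x.2) := by
    rintro ⟨r, θ⟩ ⟨hr, -⟩
    have hr0 : 0 < r := hr
    have hsymm : Complex.polarCoord.symm (r, θ) = circleMap 0 r θ := by
      rw [Complex.polarCoord_symm_apply, circleMap_zero, Complex.exp_mul_I]
      simp
    have hnorm : ‖circleMap 0 r θ‖ = r := by simp [abs_of_pos hr0]
    rw [hsymm]
    by_cases h1 : r < 1
    · have hmem : circleMap 0 r θ ∈ ball (0 : ℂ) 1 := by simpa [abs_of_pos hr0] using h1
      rw [indicator_of_mem hmem, hd, indicator_of_mem (show r ∈ Ioo (0 : ℝ) 1 from ⟨hr0, h1⟩),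
        hω.radial _ hmem, hnorm, smul_eq_mul, ENNReal.ofReal_mul hr0.le, mul_assoc]
    · have hmem : circleMap 0 r θ ∉ ball (0 : ℂ) 1 := by
        rwa [mem_ball_zero_iff, hnorm]
      rw [indicator_of_notMem hmem, hd, indicator_of_notMem fun h : r ∈ Ioo (0 : ℝ) 1 => h1 h.2]
      simp
  rw [setLIntegral_congr_fun (measurableSet_Ioi.prod measurableSet_Ioo) hcongr,
    Measure.volume_eq_prod, ← Measure.prod_restrict, lintegral_prod]
  · rw [← lintegral_indicator measurableSet_Ioo, ← lintegral_indicator measurableSet_Ioi]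
    refine lintegral_congr fun r => ?_
    by_cases hr : 0 < r
    · have hgr : Measurable fun θ => g (circleMap 0 r θ) :=
        hg.comp (continuous_circleMap 0 r).measurable
      rw [indicator_of_mem (show r ∈ Ioi (0 : ℝ) from hr)]
      dsimp only
      rw [lintegral_const_mul _ hgr, hd]
      by_cases h1 : r ∈ Ioo (0 : ℝ) 1
      · simp only [indicator_of_mem h1]
      · simp only [indicator_of_notMem h1, zero_mul]
    · rw [indicator_of_notMem (show r ∉ Ioi (0 : ℝ) from hr),
        indicator_of_notMem fun h : r ∈ Ioo (0 : ℝ) 1 => hr h.1]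
  · exact (hdm.comp_fst).mul (hg.comp hcm.measurable).aemeasurable

theorem setLIntegral_weightMeasure (hω : IsRegularWeight ω) {h : ℂ → ℂ}
    (hh : ContinuousOn h (ball 0 1)) (q ρ : ℝ) :
    ∫⁻ z in {z : Disc | ρ < ‖(z : ℂ)‖}, ‖h z‖ₑ ^ q ∂weightMeasure ω =
      ∫⁻ r in Ioo (max ρ 0) 1, ENNReal.ofReal (r * (ω (r : ℂ) / Real.pi)) *
        ∫⁻ θ in Ioo (-Real.pi) Real.pi, ‖h (circleMap 0 r θ)‖ₑ ^ q := by
  set A : Set ℂ := {z | ρ < ‖z‖} with hA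
  have hAm : MeasurableSet A := measurableSet_lt measurable_const measurable_norm
  -- Extension by zero makes the integrand Borel on `ℂ`, although `h` is continuous only on the
  -- disc.
  set g : ℂ → ℝ≥0∞ := (A ∩ ball 0 1).indicator fun z => ‖h z‖ₑ ^ q with hg
  have hgm : Measurable g := by
    have h1 : Measurable ((ball (0 : ℂ) 1).indicator h) := by
      classical
      rw [← Set.piecewise_eq_indicator]
      exact hh.measurable_piecewise continuousOn_const measurableSet_ball
    have h2 : g = (A ∩ ball 0 1).indicator fun z => ‖(ball (0 : ℂ) 1).indicator h z‖ₑ ^ q := by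
      rw [hg]
      exact indicator_congr fun z hz => by rw [indicator_of_mem hz.2]
    rw [h2]
    exact (h1.enorm.pow_const q).indicator (hAm.inter measurableSet_ball)
  have hmeas : MeasurableSet {z : Disc | ρ < ‖(z : ℂ)‖} := measurable_subtype_coe hAm
  rw [← lintegral_indicator hmeas]
  have hcongr : ∀ z : Disc, {z : Disc | ρ < ‖(z : ℂ)‖}.indicator (fun z => ‖h z‖ₑ ^ q) z = g z := by
    intro z
    by_cases hz : ρ < ‖(z : ℂ)‖
    · rw [indicator_of_mem (show z ∈ {z : Disc | ρ < ‖(z : ℂ)‖} from hz), hg,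
        indicator_of_mem (show (z : ℂ) ∈ A ∩ ball 0 1 from ⟨hz, z.2⟩)]
    · rw [indicator_of_notMem (show z ∉ {z : Disc | ρ < ‖(z : ℂ)‖} from hz), hg,
        indicator_of_notMem fun h : (z : ℂ) ∈ A ∩ ball 0 1 => hz h.1]
  rw [lintegral_congr hcongr, hω.lintegral_weightMeasure hgm,
    ← lintegral_indicator measurableSet_Ioo, ← lintegral_indicator measurableSet_Ioo]
  refine lintegral_congr fun r => ?_
  by_cases hr : r ∈ Ioo (0 : ℝ) 1
  · have hnorm : ∀ θ, ‖circleMap 0 r θ‖ = r := fun θ => by simp [abs_of_pos hr.1]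
    rw [indicator_of_mem hr]
    by_cases hρ : ρ < r
    · rw [indicator_of_mem (show r ∈ Ioo (max ρ 0) 1 from ⟨max_lt hρ hr.1, hr.2⟩)]
      congr 1
      refine lintegral_congr fun θ => ?_
      have hmem : circleMap 0 r θ ∈ A ∩ ball 0 1 := by
        rw [mem_inter_iff, mem_ball_zero_iff, hA, mem_ofPred_eq, hnorm]
        exact ⟨hρ, hr.2⟩
      rw [hg, indicator_of_mem hmem]
    · rw [indicator_of_notMem fun h : r ∈ Ioo (max ρ 0) 1 => hρ ((le_max_left _ _).trans_lt h.1)]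
      have : ∀ θ, g (circleMap 0 r θ) = 0 := fun θ =>
        indicator_of_notMem (fun h => hρ (by simpa [hA, hnorm] using h.1)) _
      simp [this]
  · rw [indicator_of_notMem hr, indicator_of_notMem fun h : r ∈ Ioo (max ρ 0) 1 =>
      hr ⟨(le_max_right _ _).trans_lt h.1, h.2⟩]

/-! ### Uniform bounds for composition near the boundary -/

/-- Composition operators are bounded on the part of the disc near the boundary, with a bound that
depends only on a bound for the value of the symbol at the origin. -/
theorem exists_setLIntegral_comp_le (hω : IsRegularWeight ω) {α : ℝ} (hα0 : 0 ≤ α) (hα : α < 1)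
    {q : ℝ} (hq : 1 ≤ q) :
    ∃ K : ℝ≥0∞, K ≠ ∞ ∧ ∀ F Φ : ℂ → ℂ, DifferentiableOn ℂ F (ball 0 1) →
      DifferentiableOn ℂ Φ (ball 0 1) → MapsTo Φ (ball 0 1) (ball 0 1) → ‖Φ 0‖ ≤ α →
      ∀ ρ : ℝ, ∫⁻ z in {z : Disc | ρ < ‖(z : ℂ)‖}, ‖F (Φ z)‖ₑ ^ q ∂weightMeasure ω ≤
        K * ∫⁻ z in {z : Disc | ρ < ‖(z : ℂ)‖}, ‖F z‖ₑ ^ q ∂weightMeasure ω := by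
  -- Half the Schwarz–Pick constant `(1 - α) / 8`, so that closed discs land in open ones.
  set κ := (1 - α) / 16 with hκ
  have hκ0 : 0 < κ := by rw [hκ]; linarith
  have hκ1 : κ ≤ 1 := by rw [hκ]; linarith
  obtain ⟨K, hK, hKω⟩ := hω.exists_le_mul hκ0 hκ1
  -- `K` comes from the weight, `4 / (1 - α)` from subordination and `1 / κ` from the Jacobian of
  -- `T`.
  set L := K * (4 / (1 - α)) / κ with hL
  have hα1 : 0 < 1 - α := sub_pos.2 hα
  refine ⟨ENNReal.ofReal L, ENNReal.ofReal_ne_top, fun F Φ hF hΦ hmap hΦ0 ρ => ?_⟩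
  have hFΦ : ContinuousOn (fun z => F (Φ z)) (ball 0 1) :=
    hF.continuousOn.comp hΦ.continuousOn hmap
  rw [hω.setLIntegral_weightMeasure hFΦ, hω.setLIntegral_weightMeasure hF.continuousOn]
  set G : ℝ → ℝ≥0∞ := fun r => ENNReal.ofReal (r * (ω (r : ℂ) / Real.pi)) *
    ∫⁻ θ in Ioo (-Real.pi) Real.pi, ‖F (circleMap 0 r θ)‖ₑ ^ q with hG
  set T : ℝ → ℝ := fun r => 1 - κ * (1 - r) with hT
  have hpoint : ∀ r ∈ Ioo (max ρ 0) 1, ENNReal.ofReal (r * (ω (r : ℂ) / Real.pi)) *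
      ∫⁻ θ in Ioo (-Real.pi) Real.pi, ‖F (Φ (circleMap 0 r θ))‖ₑ ^ q ≤
      ENNReal.ofReal L * (ENNReal.ofReal |κ| * G (T r)) := by
    intro r hr
    have hr0 : 0 < r := (le_max_right _ _).trans_lt hr.1
    have h1r : 0 < 1 - r := sub_pos.2 hr.2
    have hrT : r ≤ T r := by simp only [hT]; nlinarith
    have hT1 : T r < 1 := by simp only [hT]; nlinarith [mul_pos hκ0 h1r]
    have hTα : (1 - α) / 2 ≤ T r - ‖Φ 0‖ := by
      have : κ * (1 - r) ≤ κ := by nlinarith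
      simp only [hT]
      rw [hκ] at this ⊢
      linarith
    have hTmap : MapsTo Φ (closedBall 0 r) (ball 0 (T r)) := by
      intro z hz
      rw [mem_closedBall_zero_iff] at hz
      have h1 := le_one_sub_norm_of_mapsTo_ball hΦ hmap
        (mem_ball_zero_iff.2 (hz.trans_lt hr.2))
      have h2 : (1 - α) * (1 - r) ≤ (1 - ‖Φ 0‖) * (1 - ‖z‖) :=
        mul_le_mul (by linarith) (by linarith) h1r.le (by linarith)
      have h3 : 0 < (1 - α) * (1 - r) := mul_pos hα1 h1r
      rw [mem_ball_zero_iff]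
      simp only [hT, hκ]
      linarith
    have hcirc := lintegral_circle_comp_le hF hΦ hr0.le hr.2 (hr0.trans_le hrT) hT1 hTmap hq
    have hquot : (T r + ‖Φ 0‖) / (T r - ‖Φ 0‖) ≤ 4 / (1 - α) := by
      rw [div_le_div_iff₀ (by linarith) hα1]
      nlinarith
    have hweight : r * (ω (r : ℂ) / Real.pi) ≤ K * (T r * (ω (T r : ℂ) / Real.pi)) := by
      have h1 := hKω r ⟨hr0.le, hr.2⟩
      have h2 : 0 ≤ ω (T r : ℂ) := hω.nonneg_ofReal ⟨(hr0.le.trans hrT), hT1⟩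
      have h3 : r * ω (r : ℂ) ≤ T r * (K * ω (T r : ℂ)) :=
        mul_le_mul hrT h1 (hω.nonneg_ofReal ⟨hr0.le, hr.2⟩) (hr0.le.trans hrT)
      rw [mul_div_assoc', mul_div_assoc', mul_div_assoc']
      exact div_le_div_of_nonneg_right (h3.trans_eq (by ring)) Real.pi_pos.le
    calc _ ≤ ENNReal.ofReal (K * (T r * (ω (T r : ℂ) / Real.pi))) *
          (ENNReal.ofReal (4 / (1 - α)) *
            ∫⁻ θ in Ioo (-Real.pi) Real.pi, ‖F (circleMap 0 (T r) θ)‖ₑ ^ q) :=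
          mul_le_mul' (ENNReal.ofReal_le_ofReal hweight)
            (hcirc.trans (mul_le_mul_left (ENNReal.ofReal_le_ofReal hquot) _))
      _ = ENNReal.ofReal L * (ENNReal.ofReal |κ| * G (T r)) := by
          have hLκ : K * (4 / (1 - α)) = L * |κ| := by
            rw [hL, abs_of_pos hκ0, div_mul_cancel₀ _ hκ0.ne']
          have hL0 : 0 ≤ L := by positivity
          have h4 : 0 ≤ 4 / (1 - α) := by positivity
          rw [← mul_assoc (ENNReal.ofReal L), ← ENNReal.ofReal_mul hL0, ← hLκ,
            ENNReal.ofReal_mul hK.le, ENNReal.ofReal_mul hK.le]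
          simp only [hG]
          ring
  have hder : ∀ r ∈ Ioo (max ρ 0) 1, HasDerivWithinAt T κ (Ioo (max ρ 0) 1) r := by
    intro r _
    have := ((((hasDerivAt_id r).const_sub 1).const_mul κ).const_sub 1).hasDerivWithinAt
      (s := Ioo (max ρ 0) 1)
    simpa [hT] using this
  have hinj : InjOn T (Ioo (max ρ 0) 1) := by
    intro a _ b _ hab
    have : κ * (1 - a) = κ * (1 - b) := by simp only [hT] at hab; linarith
    linarith [mul_left_cancel₀ hκ0.ne' this]
  -- `T` pushes radii outwards, so the same `ρ` serves on both sides of the estimate.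
  have himage : T '' Ioo (max ρ 0) 1 ⊆ Ioo (max ρ 0) 1 := by
    rintro _ ⟨r, hr, rfl⟩
    have h1r : 0 < 1 - r := sub_pos.2 hr.2
    exact ⟨hr.1.trans_le (by simp only [hT]; nlinarith),
      by simp only [hT]; nlinarith [mul_pos hκ0 h1r]⟩
  calc _ ≤ ∫⁻ r in Ioo (max ρ 0) 1, ENNReal.ofReal L * (ENNReal.ofReal |κ| * G (T r)) :=
        setLIntegral_mono' measurableSet_Ioo hpoint
    _ = ENNReal.ofReal L * ∫⁻ s in T '' Ioo (max ρ 0) 1, G s := by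
        rw [lintegral_const_mul' _ _ ENNReal.ofReal_ne_top,
          lintegral_image_eq_lintegral_abs_deriv_mul measurableSet_Ioo hder hinj]
    _ ≤ _ := mul_le_mul_right (lintegral_mono_set himage) _

end IsRegularWeight

/-! ### Weighted composition of functions on the disc -/

theorem IsAnalyticOnDisc.continuous {f : Disc → ℂ} (hf : IsAnalyticOnDisc f) : Continuous f := by
  obtain ⟨F, hF, h⟩ := hf
  rw [show f = fun z : Disc => F z from funext h]
  exact hF.continuousOn.comp_continuous continuous_subtype_val fun z => z.2

theorem IsAnalyticOnDisc.mul {f g : Disc → ℂ} (hf : IsAnalyticOnDisc f)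
    (hg : IsAnalyticOnDisc g) : IsAnalyticOnDisc fun z => f z * g z := by
  obtain ⟨F, hF, h⟩ := hf
  obtain ⟨G, hG, h'⟩ := hg
  exact ⟨fun z => F z * G z, hF.mul hG, fun z => congrArg₂ _ (h z) (h' z)⟩

theorem IsAnalyticOnDisc.comp {f : Disc → ℂ} {φ : Disc → Disc} (hf : IsAnalyticOnDisc f)
    (hφ : IsAnalyticOnDisc fun z => (φ z : ℂ)) : IsAnalyticOnDisc fun z => f (φ z) := by
  obtain ⟨F, hF, h⟩ := hf
  obtain ⟨Φ, hΦ, h'⟩ := hφ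
  refine ⟨fun z => F (Φ z), hF.comp hΦ fun z hz => ?_,
    fun z => (h (φ z)).trans (congrArg F (h' z))⟩
  rw [← h' ⟨z, hz⟩]
  exact (φ ⟨z, hz⟩).2

/-- The origin as a point of the disc. -/
def Disc.origin : Disc := ⟨0, mem_ball_self one_pos⟩

theorem one_sub_norm_le_of_isAnalyticOnDisc {φ : Disc → Disc}
    (hφ : IsAnalyticOnDisc fun z => (φ z : ℂ)) (z : Disc) :
    (1 - ‖(φ Disc.origin : ℂ)‖) * (1 - ‖(z : ℂ)‖) / 8 ≤ 1 - ‖(φ z : ℂ)‖ := by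
  obtain ⟨Φ, hΦ, h⟩ := hφ
  change ∀ z, (φ z : ℂ) = Φ z at h
  have hmap : MapsTo Φ (ball 0 1) (ball 0 1) := fun w hw => by
    rw [← h ⟨w, hw⟩]
    exact (φ ⟨w, hw⟩).2
  rw [h, h]
  exact le_one_sub_norm_of_mapsTo_ball hΦ hmap z.2

/-- The part of the disc outside a concentric closed disc. -/
def outerAnnulus (ρ : ℝ) : Set Disc := {z | ρ < ‖(z : ℂ)‖}

theorem measurableSet_outerAnnulus (ρ : ℝ) : MeasurableSet (outerAnnulus ρ) :=
  measurableSet_lt measurable_const measurable_subtype_coe.norm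

theorem outerAnnulus_of_neg {ρ : ℝ} (hρ : ρ < 0) : outerAnnulus ρ = univ :=
  eq_univ_of_forall fun z => hρ.trans_le (norm_nonneg (z : ℂ))

theorem enorm_le_hardyInfNorm (f : Disc → ℂ) (z : Disc) : ‖f z‖ₑ ≤ hardyInfNorm f :=
  le_iSup (fun z => ‖f z‖ₑ) z

/-- Freedom in `ρ` serves two ends: negative `ρ` gives boundedness on the whole space, `ρ` near 1
gives small tails. Uniformity in `φ` covers all small times at once. -/
theorem IsRegularWeight.exists_eLpNorm_weightedComp_le {ω : ℂ → ℝ} (hω : IsRegularWeight ω)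
    {p : ℝ≥0∞} (hp1 : 1 ≤ p) (hp : p ≠ ∞) {α : ℝ} (hα0 : 0 ≤ α) (hα : α < 1) :
    ∃ K : ℝ≥0∞, K ≠ ∞ ∧ ∀ (f m : Disc → ℂ) (φ : Disc → Disc), IsAnalyticOnDisc f →
      IsAnalyticOnDisc (fun z => (φ z : ℂ)) → ‖(φ Disc.origin : ℂ)‖ ≤ α →
      ∀ ρ : ℝ, eLpNorm (fun z => m z * f (φ z)) p ((weightMeasure ω).restrict (outerAnnulus ρ)) ≤
        hardyInfNorm m * (K * eLpNorm f p ((weightMeasure ω).restrict (outerAnnulus ρ))) := by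
  have hp0 : p ≠ 0 := (zero_lt_one.trans_le hp1).ne'
  have hq : 1 ≤ p.toReal := by
    rw [← ENNReal.toReal_one]
    exact ENNReal.toReal_mono hp hp1
  have hq0 : 0 < p.toReal := one_pos.trans_le hq
  obtain ⟨K, hK, h⟩ := hω.exists_setLIntegral_comp_le hα0 hα hq
  refine ⟨K ^ (1 / p.toReal), ENNReal.rpow_ne_top_of_nonneg (by positivity) hK,
    fun f m φ ⟨F, hF, hf⟩ ⟨Φ, hΦ, hφ⟩ hφ0 ρ => ?_⟩
  change ∀ z, (φ z : ℂ) = Φ z at hφ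
  have hmap : MapsTo Φ (ball 0 1) (ball 0 1) := fun w hw => by
    rw [← hφ ⟨w, hw⟩]
    exact (φ ⟨w, hw⟩).2
  rw [hφ] at hφ0
  have h1 := h F Φ hF hΦ hmap hφ0 ρ
  rw [eLpNorm_eq_lintegral_rpow_enorm_toReal hp0 hp, eLpNorm_eq_lintegral_rpow_enorm_toReal hp0 hp,
    ← ENNReal.mul_rpow_of_nonneg _ _ (by positivity),
    ← ENNReal.rpow_rpow_inv hq0.ne' (hardyInfNorm m), ← one_div,
    ← ENNReal.mul_rpow_of_nonneg _ _ (by positivity)]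
  refine ENNReal.rpow_le_rpow ?_ (by positivity)
  calc _ ≤ ∫⁻ z in outerAnnulus ρ, hardyInfNorm m ^ p.toReal * ‖F (Φ z)‖ₑ ^ p.toReal
          ∂weightMeasure ω := by
        refine lintegral_mono fun z => ?_
        simp only [enorm_mul, hf, hφ]
        rw [ENNReal.mul_rpow_of_nonneg _ _ hq0.le]
        gcongr
        exact enorm_le_hardyInfNorm m z
    _ = hardyInfNorm m ^ p.toReal * ∫⁻ z in outerAnnulus ρ, ‖F (Φ z)‖ₑ ^ p.toReal
          ∂weightMeasure ω := by
        refine lintegral_const_mul _ (Measurable.pow_const (Measurable.enorm ?_) _)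
        refine (ContinuousOn.comp_continuous (hF.continuousOn.comp hΦ.continuousOn hmap)
          continuous_subtype_val fun z => z.2).measurable
    _ ≤ _ := by
        refine mul_le_mul_right (h1.trans_eq ?_) _
        simp only [hf]
        rfl

/-! ### Sup norms of the cocycle -/

theorem IsCocycle.hardyInfNorm_add_le {φ : ℝ≥0 → Disc → Disc} {m : ℝ≥0 → Disc → ℂ}
    (hm : IsCocycle φ m) (t s : ℝ≥0) :
    hardyInfNorm (m (t + s)) ≤ hardyInfNorm (m t) * hardyInfNorm (m s) := by
  refine iSup_le fun z => ?_
  rw [hm.add, enorm_mul]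
  exact mul_le_mul' (enorm_le_hardyInfNorm _ _) (enorm_le_hardyInfNorm _ _)

/-- A bound for small times spreads to every `t` by writing `t = (n + 1) • s` with `s` small and
using submultiplicativity. -/
theorem IsCocycle.hardyInfNorm_ne_top {φ : ℝ≥0 → Disc → Disc} {m : ℝ≥0 → Disc → ℂ}
    (hm : IsCocycle φ m) {B : ℝ≥0∞} (hB : B ≠ ∞)
    (hev : ∀ᶠ t in 𝓝[>] (0 : ℝ≥0), hardyInfNorm (m t) ≤ B) (t : ℝ≥0) :
    hardyInfNorm (m t) ≠ ∞ := by
  have hzero : hardyInfNorm (m 0) ≤ 1 := iSup_le fun z => by simp [hm.zero]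
  rcases eq_or_ne t 0 with rfl | ht
  · exact ne_top_of_le_ne_top ENNReal.one_ne_top hzero
  have hlim : Tendsto (fun n : ℕ => t / ((n : ℝ≥0) + 1)) atTop (𝓝[>] 0) := by
    refine tendsto_nhdsWithin_iff.2 ⟨?_, Eventually.of_forall fun n => ?_⟩
    · have := (tendsto_one_div_add_atTop_nhds_zero_nat (𝕜 := ℝ≥0)).const_mul t
      simpa [div_eq_mul_inv] using this
    · exact div_pos (pos_iff_ne_zero.2 ht) (by positivity)
  obtain ⟨n, hn⟩ := (hlim.eventually hev).exists
  set s := t / ((n : ℝ≥0) + 1) with hs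
  have hmul : ∀ k : ℕ, hardyInfNorm (m (k • s)) ≠ ∞ := by
    intro k
    induction k with
    | zero => simpa using ne_top_of_le_ne_top ENNReal.one_ne_top hzero
    | succ k ih =>
      rw [succ_nsmul]
      exact ne_top_of_le_ne_top (ENNReal.mul_ne_top ih (ne_top_of_le_ne_top hB hn))
        (hm.hardyInfNorm_add_le _ _)
  have hts : t = (n + 1) • s := by
    rw [hs, nsmul_eq_mul]
    push_cast
    rw [mul_div_cancel₀]
    positivity
  rw [hts]
  exact hmul (n + 1)

/-! ### Strong continuity -/

variable {p : ℝ≥0∞} {ω : ℂ → ℝ}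

/-- Absolute continuity of the integral: the outer annuli decrease to the empty set and the measure
is finite, so their measures tend to 0. -/
theorem exists_eLpNorm_outerAnnulus_le (hω : IsRegularWeight ω) (hp1 : 1 ≤ p) (hp : p ≠ ∞)
    {f : Disc → ℂ} (hf : MemLp f p (weightMeasure ω)) {ε : ℝ} (hε : 0 < ε) :
    ∃ ρ : ℝ, ρ < 1 ∧ 0 ≤ ρ ∧
      eLpNorm f p ((weightMeasure ω).restrict (outerAnnulus ρ)) ≤ ENNReal.ofReal ε := by
  have := hω.isFiniteMeasure
  obtain ⟨δ, hδ, h⟩ := hf.eLpNorm_indicator_le hp1 hp hε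
  set A : ℕ → Set Disc := fun n => outerAnnulus (1 - 1 / ((n : ℝ) + 1)) with hA
  have hanti : Antitone A := by
    intro a b hab z hz
    refine lt_of_le_of_lt ?_ (show 1 - 1 / ((b : ℝ) + 1) < ‖(z : ℂ)‖ from hz)
    gcongr
  have hinter : ⋂ n, A n = ∅ := by
    refine eq_empty_of_forall_notMem fun z hz => ?_
    have hz1 : 0 < 1 - ‖(z : ℂ)‖ := sub_pos.2 (mem_ball_zero_iff.1 z.2)
    obtain ⟨n, hn⟩ := exists_nat_one_div_lt hz1
    have : 1 - 1 / ((n : ℝ) + 1) < ‖(z : ℂ)‖ := mem_iInter.1 hz n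
    linarith
  have hlim : Tendsto (fun n => weightMeasure ω (A n)) atTop (𝓝 0) := by
    have := tendsto_measure_iInter_atTop (μ := weightMeasure ω) (s := A)
      (fun n => (measurableSet_outerAnnulus (1 - 1 / ((n : ℝ) + 1))).nullMeasurableSet) hanti
      ⟨0, measure_ne_top _ _⟩
    rwa [hinter, measure_empty] at this
  obtain ⟨n, hn⟩ := (hlim.eventually_le_const (ENNReal.ofReal_pos.2 hδ)).exists
  refine ⟨1 - 1 / ((n : ℝ) + 1), by linarith [Nat.one_div_pos_of_nat (α := ℝ) (n := n)], ?_, ?_⟩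
  · rw [sub_nonneg, div_le_one (by positivity)]
    linarith [n.cast_nonneg (α := ℝ)]
  · rw [← eLpNorm_indicator_eq_eLpNorm_restrict (measurableSet_outerAnnulus _)]
    exact h _ (measurableSet_outerAnnulus _) hn

theorem eLpNorm_le_restrict_add_restrict_compl {X : Type*} [MeasurableSpace X] {μ : Measure X}
    {f : X → ℂ} (hp1 : 1 ≤ p) (hf : AEStronglyMeasurable f μ) {A : Set X}
    (hA : MeasurableSet A) :
    eLpNorm f p μ ≤ eLpNorm f p (μ.restrict A) + eLpNorm f p (μ.restrict Aᶜ) := by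
  rw [← eLpNorm_indicator_eq_eLpNorm_restrict hA, ← eLpNorm_indicator_eq_eLpNorm_restrict hA.compl]
  refine le_of_eq_of_le ?_ (eLpNorm_add_le (hf.indicator hA) (hf.indicator hA.compl) hp1)
  rw [indicator_self_add_compl]

theorem isAnalyticOnDisc_weightedComp {φ : ℝ≥0 → Disc → Disc} (hφ : IsAnalyticSemigroup φ)
    {m : ℝ≥0 → Disc → ℂ} (hm : IsCocycle φ m) {f : Disc → ℂ} (hf : IsAnalyticOnDisc f) (t : ℝ≥0) :
    IsAnalyticOnDisc fun z => m t z * f (φ t z) :=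
  (hm.analytic t).mul (hf.comp (hφ.analytic t))

/-- A weighted composition semigroup is strongly continuous on functions over a compact part of
the disc. -/
theorem tendsto_eLpNorm_compl_outerAnnulus (hω : IsRegularWeight ω) (hp1 : 1 ≤ p) (hp : p ≠ ∞)
    {φ : ℝ≥0 → Disc → Disc} (hφ : IsAnalyticSemigroup φ) {m : ℝ≥0 → Disc → ℂ}
    (hm : IsCocycle φ m) {B : ℝ≥0∞} (hB : B ≠ ∞)
    (hev : ∀ᶠ t in 𝓝[>] (0 : ℝ≥0), hardyInfNorm (m t) ≤ B)
    (hev0 : ∀ᶠ t in 𝓝[>] (0 : ℝ≥0), ‖(φ t Disc.origin : ℂ)‖ ≤ 1 / 2)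
    {f : Disc → ℂ} (hf : IsAnalyticOnDisc f) {ρ : ℝ} (hρ0 : 0 ≤ ρ) (hρ : ρ < 1) :
    Tendsto (fun t => eLpNorm (fun z => m t z * f (φ t z) - f z) p
      ((weightMeasure ω).restrict (outerAnnulus ρ)ᶜ)) (𝓝[>] 0) (𝓝 0) := by
  have := hω.isFiniteMeasure
  have hp0 : p ≠ 0 := (zero_lt_one.trans_le hp1).ne'
  have hq0 : 0 < p.toReal := ENNReal.toReal_pos hp0 hp
  -- With `‖φ_t(0)‖ ≤ 1 / 2`, Schwarz–Pick keeps `φ_t(z)` in the disc of radius `R` whenever `‖z‖ ≤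
  -- ρ`. There `f` is bounded, which gives a constant dominating function.
  set R := 1 - (1 - ρ) / 16 with hR
  have hρR : ρ ≤ R := by rw [hR]; linarith
  have hR1 : R < 1 := by rw [hR]; linarith
  obtain ⟨C, hC⟩ : ∃ C : ℝ≥0∞, C ≠ ∞ ∧ ∀ z : Disc, ‖(z : ℂ)‖ ≤ R → ‖f z‖ₑ ≤ C := by
    obtain ⟨F, hF, hfF⟩ := hf
    obtain ⟨C, hC⟩ := (isCompact_closedBall (0 : ℂ) R).exists_bound_of_continuousOn
      (hF.continuousOn.mono (closedBall_subset_ball hR1))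
    refine ⟨ENNReal.ofReal C, ENNReal.ofReal_ne_top, fun z hz => ?_⟩
    rw [hfF, ← ofReal_norm]
    exact ENNReal.ofReal_le_ofReal (hC z (by simpa using hz))
  have hmeas : ∀ t, Measurable fun z => ‖m t z * f (φ t z) - f z‖ₑ ^ p.toReal := fun t =>
    ((isAnalyticOnDisc_weightedComp hφ hm hf t).continuous.sub
      hf.continuous).measurable.enorm.pow_const _
  have hdct : Tendsto (fun t => ∫⁻ z in (outerAnnulus ρ)ᶜ,
      ‖m t z * f (φ t z) - f z‖ₑ ^ p.toReal ∂weightMeasure ω) (𝓝[>] 0)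
      (𝓝 (∫⁻ _ in (outerAnnulus ρ)ᶜ, 0 ∂weightMeasure ω)) := by
    refine tendsto_lintegral_filter_of_dominated_convergence
      (fun _ => (B * C + C) ^ p.toReal) (Eventually.of_forall hmeas) ?_ ?_ ?_
    · filter_upwards [hev, hev0] with t ht ht0
      refine (ae_restrict_iff' (measurableSet_outerAnnulus ρ).compl).2 (ae_of_all _ fun z hz => ?_)
      have hzρ : ‖(z : ℂ)‖ ≤ ρ := not_lt.1 hz
      have hφz : ‖(φ t z : ℂ)‖ ≤ R := by
        have h1 := one_sub_norm_le_of_isAnalyticOnDisc (hφ.analytic t) z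
        have h2 : (1 / 2) * (1 - ρ) ≤ (1 - ‖(φ t Disc.origin : ℂ)‖) * (1 - ‖(z : ℂ)‖) :=
          mul_le_mul (by linarith) (by linarith) (by linarith) (by linarith)
        rw [hR]
        linarith
      refine ENNReal.rpow_le_rpow (enorm_sub_le.trans (add_le_add ?_ ?_)) hq0.le
      · rw [enorm_mul]
        exact mul_le_mul' ((enorm_le_hardyInfNorm _ z).trans ht) (hC.2 _ hφz)
      · exact hC.2 z (hzρ.trans hρR)
    · rw [lintegral_const]
      exact ENNReal.mul_ne_top (ENNReal.rpow_ne_top_of_nonneg hq0.le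
        (ENNReal.add_ne_top.2 ⟨ENNReal.mul_ne_top hB hC.1, hC.1⟩)) (measure_ne_top _ _)
    · refine ae_of_all _ fun z => ?_
      have h1 : Tendsto (fun t => m t z * f (φ t z) - f z) (𝓝[>] 0) (𝓝 0) := by
        have := ((hm.tendsto z).mul
          ((hf.continuous.tendsto z).comp (hφ.tendsto z))).sub_const (f z)
        simpa using this
      have h2 := (ENNReal.continuous_rpow_const (y := p.toReal)).tendsto 0 |>.comp
        (by simpa using h1.enorm)
      rwa [ENNReal.zero_rpow_of_pos hq0] at h2
  rw [lintegral_zero] at hdct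
  have h := (ENNReal.continuous_rpow_const (y := 1 / p.toReal)).tendsto 0 |>.comp hdct
  rw [ENNReal.zero_rpow_of_pos (by positivity)] at h
  simp only [eLpNorm_eq_lintegral_rpow_enorm_toReal hp0 hp]
  exact h

theorem tendsto_eLpNorm_weightedComp_sub (hω : IsRegularWeight ω) (hp1 : 1 ≤ p) (hp : p ≠ ∞)
    {φ : ℝ≥0 → Disc → Disc} (hφ : IsAnalyticSemigroup φ) {m : ℝ≥0 → Disc → ℂ}
    (hm : IsCocycle φ m) {B : ℝ≥0∞} (hB : B ≠ ∞)
    (hev : ∀ᶠ t in 𝓝[>] (0 : ℝ≥0), hardyInfNorm (m t) ≤ B)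
    {f : Disc → ℂ} (hf : IsAnalyticOnDisc f) (hfp : MemLp f p (weightMeasure ω)) :
    Tendsto (fun t => eLpNorm (fun z => m t z * f (φ t z) - f z) p (weightMeasure ω))
      (𝓝[>] 0) (𝓝 0) := by
  have hev0 : ∀ᶠ t in 𝓝[>] (0 : ℝ≥0), ‖(φ t Disc.origin : ℂ)‖ ≤ 1 / 2 := by
    have h1 : Tendsto (fun t => ‖(φ t Disc.origin : ℂ)‖) (𝓝[>] 0) (𝓝 ‖(Disc.origin : ℂ)‖) :=
      ((continuous_subtype_val.tendsto _).comp (hφ.tendsto Disc.origin)).norm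
    refine h1.eventually_le_const ?_
    simp [Disc.origin]
  obtain ⟨K, hK, hKbound⟩ := hω.exists_eLpNorm_weightedComp_le hp1 hp
    (α := 1 / 2) (by norm_num) (by norm_num)
  -- On the outer annulus, `S_t f` contributes the factor `B * K` and `f` itself the factor 1.
  set D := B * K + 1 with hD
  have hDtop : D ≠ ∞ := ENNReal.add_ne_top.2 ⟨ENNReal.mul_ne_top hB hK, ENNReal.one_ne_top⟩
  have hD0 : D ≠ 0 := by simp [hD]
  refine ENNReal.tendsto_nhds_zero.2 fun ε hε => ?_
  obtain ⟨δ, hδ0, hδ⟩ : ∃ δ : ℝ, 0 < δ ∧ D * ENNReal.ofReal δ ≤ ε / 2 := by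
    have hpos : 0 < ε / 2 / D :=
      ENNReal.div_pos (ENNReal.half_pos hε.ne').ne' hDtop
    obtain ⟨δ, hδ0, hδ⟩ := ENNReal.lt_iff_exists_nnreal_btwn.1 hpos
    refine ⟨δ, by exact_mod_cast hδ0, ?_⟩
    rw [ENNReal.ofReal_coe_nnreal, mul_comm]
    exact (ENNReal.le_div_iff_mul_le (Or.inl hD0) (Or.inl hDtop)).1 hδ.le
  obtain ⟨ρ, hρ1, hρ0, hρ⟩ := exists_eLpNorm_outerAnnulus_le hω hp1 hp hfp hδ0
  have hinner := ENNReal.tendsto_nhds_zero.1 (tendsto_eLpNorm_compl_outerAnnulus hω hp1 hp hφ hm hB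
    hev hev0 hf hρ0 hρ1) (ε / 2) (ENNReal.half_pos hε.ne')
  filter_upwards [hinner, hev, hev0] with t ht1 ht2 ht3
  have hcont := (isAnalyticOnDisc_weightedComp hφ hm hf t).continuous
  refine (eLpNorm_le_restrict_add_restrict_compl hp1
    (hcont.sub hf.continuous).aestronglyMeasurable (measurableSet_outerAnnulus ρ)).trans ?_
  rw [← ENNReal.add_halves ε]
  refine add_le_add ?_ ht1
  set N := eLpNorm f p ((weightMeasure ω).restrict (outerAnnulus ρ)) with hN
  calc _ ≤ eLpNorm (fun z => m t z * f (φ t z)) p ((weightMeasure ω).restrict (outerAnnulus ρ)) +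
        N := eLpNorm_sub_le hcont.aestronglyMeasurable hf.continuous.aestronglyMeasurable hp1
    _ ≤ B * (K * N) + N := by
        gcongr
        exact (hKbound f (m t) (φ t) hf (hφ.analytic t) ht3 ρ).trans (by gcongr)
    _ = D * N := by rw [hD]; ring
    _ ≤ D * ENNReal.ofReal δ := by gcongr
    _ ≤ ε / 2 := hδ

theorem exists_eLpNorm_weightedComp_le_mul (hω : IsRegularWeight ω) (hp1 : 1 ≤ p) (hp : p ≠ ∞)
    {φ : ℝ≥0 → Disc → Disc} (hφ : IsAnalyticSemigroup φ) {m : ℝ≥0 → Disc → ℂ} {t : ℝ≥0}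
    (hm : hardyInfNorm (m t) ≠ ∞) :
    ∃ K : ℝ≥0∞, K ≠ ∞ ∧ ∀ f : Disc → ℂ, IsAnalyticOnDisc f →
      eLpNorm (fun z => m t z * f (φ t z)) p (weightMeasure ω) ≤
        K * eLpNorm f p (weightMeasure ω) := by
  obtain ⟨K, hK, h⟩ := hω.exists_eLpNorm_weightedComp_le hp1 hp
    (norm_nonneg (φ t Disc.origin : ℂ)) (mem_ball_zero_iff.1 (φ t Disc.origin).2)
  refine ⟨hardyInfNorm (m t) * K, ENNReal.mul_ne_top hm hK, fun f hf => ?_⟩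
  -- The annulus with `ρ = -1` is the whole disc.
  have := h f (m t) (φ t) hf (hφ.analytic t) le_rfl (-1)
  rwa [outerAnnulus_of_neg (by norm_num), Measure.restrict_univ, ← mul_assoc] at this

/-! ### The operators on the Bergman space -/

/-- A weighted composition operator on the Bergman space, as a linear map. -/
noncomputable def weightedCompLinearMap (ψ : Disc → ℂ) (φ : Disc → Disc)
    (h : ∀ f ∈ bergmanSubmodule p ω, (fun z => ψ z * f (φ z)) ∈ bergmanSubmodule p ω) :
    BergmanSpace p ω →ₗ[ℂ] BergmanSpace p ω where
  toFun f := ⟨fun z => ψ z * f (φ z), h f.1 f.2⟩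
  map_add' f g := Subtype.ext (funext fun z => mul_add (ψ z) (f (φ z)) (g (φ z)))
  map_smul' c f := Subtype.ext (funext fun z => mul_left_comm (ψ z) c (f (φ z)))

theorem BergmanSpace.norm_eq [Fact (1 ≤ p)] (f : BergmanSpace p ω) :
    ‖f‖ = (eLpNorm f p (weightMeasure ω)).toReal := rfl

end WeightedComposition

theorem corollary3p4 (p : ℝ≥0∞) [Fact (1 ≤ p)] (hp : p ≠ ∞)
    (ω : ℂ → ℝ) (hω : WeightedComposition.IsRegularWeight ω)
    (φ : ℝ≥0 → WeightedComposition.Disc → WeightedComposition.Disc)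
    (hφ : WeightedComposition.IsAnalyticSemigroup φ)
    (m : ℝ≥0 → WeightedComposition.Disc → ℂ)
    (hm : WeightedComposition.IsCocycle φ m)
    (hlim : limsup (fun t => WeightedComposition.hardyInfNorm (m t)) (𝓝[>] 0) < ∞) :
    ∃ S : ℝ≥0 → WeightedComposition.BergmanSpace p ω →L[ℂ] WeightedComposition.BergmanSpace p ω,
      (∀ t f z, S t f z = m t z * f (φ t z)) ∧
        WeightedComposition.IsStronglyContinuousSemigroup S := by
  open WeightedComposition in
  have hp1 : 1 ≤ p := Fact.out
  -- A finite `B` strictly above the limsup eventually bounds the norms of `m t` themselves.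
  obtain ⟨B, hlimB, hB⟩ := exists_between hlim
  have hev : ∀ᶠ t in 𝓝[>] (0 : ℝ≥0), hardyInfNorm (m t) ≤ B :=
    (eventually_lt_of_limsup_lt hlimB).mono fun t ht => ht.le
  choose K hK hbound using fun t => exists_eLpNorm_weightedComp_le_mul hω hp1 hp hφ
    (hm.hardyInfNorm_ne_top hB.ne hev t)
  have hmem : ∀ t, ∀ f ∈ bergmanSubmodule p ω,
      (fun z => m t z * f (φ t z)) ∈ bergmanSubmodule p ω := by
    rintro t f ⟨hf, hfp⟩
    have hfa := isAnalyticOnDisc_weightedComp hφ hm hf t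
    exact ⟨hfa, hfa.continuous.aestronglyMeasurable,
      (hbound t f hf).trans_lt (ENNReal.mul_lt_top (hK t).lt_top hfp.2)⟩
  have hnorm : ∀ t (f : BergmanSpace p ω),
      ‖weightedCompLinearMap (m t) (φ t) (hmem t) f‖ ≤ (K t).toReal * ‖f‖ := by
    intro t f
    rw [BergmanSpace.norm_eq, BergmanSpace.norm_eq, ← ENNReal.toReal_mul]
    exact ENNReal.toReal_mono (ENNReal.mul_ne_top (hK t) f.2.2.2.ne) (hbound t f f.2.1)
  refine ⟨fun t => (weightedCompLinearMap (m t) (φ t) (hmem t)).mkContinuous _ (hnorm t),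
    fun t f z => rfl, ?_, ?_, ?_⟩
  · refine ContinuousLinearMap.ext fun f => Subtype.ext (funext fun z => ?_)
    change m 0 z * f (φ 0 z) = f z
    rw [hm.zero, hφ.zero, one_mul]
  -- Composing operators composes symbols in reverse order, giving `φ s (φ t z)`; commutativity of
  -- addition in time restores `φ (t + s) z`.
  · refine fun t s => ContinuousLinearMap.ext fun f => Subtype.ext (funext fun z => ?_)
    change m t z * (m s (φ t z) * f (φ s (φ t z))) = m (t + s) z * f (φ (t + s) z)
    rw [hm.add, hφ.add, add_comm s t, mul_assoc]
  · intro f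
    refine tendsto_iff_norm_sub_tendsto_zero.2 ?_
    have h := (ENNReal.tendsto_toReal ENNReal.zero_ne_top).comp
      (tendsto_eLpNorm_weightedComp_sub hω hp1 hp hφ hm hB.ne hev f.2.1 f.2.2)
    exact h
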